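/- Let $\mathbf{k}$ be any field, let $n\ge 0$ be an integer, and let $S=\mathbf{k}[x_0,\dots,x_n]$, with $S_e$ the space of forms of degree $e$ (zero for $e<0$). For integers $d\ge 1$, $b$, $q$ and $p\ge 0$ let the Veronese Koszul cohomology group $K_{p,q}(n,b;d)=K_{p,q}(\mathbf{P}^n,\mathcal{O}(b);\mathcal{O}(d))$ be the cohomology at the middle term of the Koszul complex $$\textstyle\bigwedge^{p+1}S_d\otimes S_{(q-1)d+b}\to\bigwedge^{p}S_d\otimes S_{qd+b}\to\bigwedge^{p-1}S_d\otimes S_{(q+1)d+b}$$ with differential $(v_0\wedge\dots\wedge v_s)\otimes g\mapsto\sum_i(-1)^i(v_0\wedge\dots\widehat{v_i}\dots\wedge v_s)\otimes v_ig$ (and $\bigwedge^{-1}S_d=0$). **Theorem 1.1.** (1) Let $d\ge 2$, $b\in[0,d-1]$ and $q\in[0,\,n+1-\frac{n+b}{d}]$ be integers, and let $m$ and $r$ be the quotient and the remainder of $qd+b$ divided by $d-1$. Then $K_{p,q}(n,b;d)\ne 0$ for every integer $p\ge 0$ with $$\binom{m+d}{m}-\binom{m+d-r-1}{m}-m\ \le\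 p\ \le\ \binom{n+d}{n}+\binom{n-m+r}{r}-\binom{n-m+d}{d}-m-1 .$$ Here $\binom{x}{j}=x(x-1)\cdots(x-j+1)/j!$ for integers $x$ and $j\ge 0$; when $m\le n$ the last two binomial coefficients are $\binom{n-m+r}{n-m}$ and $\binom{n-m+d}{n-m}$. (2) In particular, if $1\le q\le n$, $b\ge 0$ and $d\ge q+b+1$, then $K_{p,q}(n,b;d)\ne 0$ for every $p\ge 0$ with $$\binom{d+q}{q}-\binom{d-b-1}{q}-q\ \le\ p\ \le\ \binom{d+n}{n}-\binom{d+n-q}{n-q}+\binom{n+b}{n-q}-q-1 .$$ (3) In particular (Ottaviani–Paoletti), if $d\ge 3$, then $K_{p,2}(2,0;d)\ne 0$ for every $p$ with $3d-2\le p\le\binom{d+2}{2}-3$. -/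

import Mathlib

open scoped TensorProduct

noncomputable section

namespace VeroneseKoszul

section ExteriorPower

variable (k V : Type*) [CommRing k] [AddCommGroup V] [Module k V] (p : ℕ)

/-- The exterior power `⋀^p V`: Mathlib's exterior power as a type of its own, with its additive
group and module structure (this only speeds up the search for instances on tensor products). -/
def ExtPower : Type _ := ⋀[k]^p V

instance : AddCommGroup (ExtPower k V p) := inferInstanceAs (AddCommGroup (⋀[k]^p V))

instance : Module k (ExtPower k V p) := inferInstanceAs (Module k (⋀[k]^p V))

/-- The identity, as an isomorphism with Mathlib's exterior power. -/
def ExtPower.equiv : ExtPower k V p ≃ₗ[k] ⋀[k]^p V := LinearEquiv.refl k _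

/-- The alternating map `(w₁, …, w_p) ↦ w₁ ∧ ⋯ ∧ w_p`. -/
def ExtPower.wedge : V [⋀^Fin p]→ₗ[k] ExtPower k V p :=
  (ExtPower.equiv k V p).symm.toLinearMap.compAlternatingMap (exteriorPower.ιMulti k p)

end ExteriorPower

section Koszul

variable {k V M N : Type*} [CommRing k] [AddCommGroup V] [Module k V]
  [AddCommGroup M] [Module k M] [AddCommGroup N] [Module k N]

/-- For a bilinear multiplication `μ : V × M → N`, the linear map sending `v` to the alternating
map that sends `(w₁, …, w_p)` to the linear map `g ↦ (w₁ ∧ ⋯ ∧ w_p) ⊗ (v · g)`. -/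
def koszulTerm (μ : V →ₗ[k] M →ₗ[k] N) (p : ℕ) :
    V →ₗ[k] V [⋀^Fin p]→ₗ[k] (M →ₗ[k] ExtPower k V p ⊗[k] N) where
  toFun v := ((TensorProduct.mk k (ExtPower k V p) N).compl₂ (μ v)).compAlternatingMap
    (ExtPower.wedge k V p)
  map_add' v w := by
    ext x g
    simp [TensorProduct.tmul_add]
  map_smul' c v := by
    ext x g
    simp

/-- The Koszul differential `⋀^(p+1) V ⊗ M → ⋀^p V ⊗ N`,
`(v₀ ∧ ⋯ ∧ v_p) ⊗ g ↦ ∑ᵢ (-1)^i (v₀ ∧ ⋯ v̂ᵢ ⋯ ∧ v_p) ⊗ (vᵢ · g)`. -/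
def koszulDifferential (μ : V →ₗ[k] M →ₗ[k] N) (p : ℕ) :
    ExtPower k V (p + 1) ⊗[k] M →ₗ[k] ExtPower k V p ⊗[k] N :=
  TensorProduct.lift
    (exteriorPower.alternatingMapLinearEquiv
        (AlternatingMap.alternatizeUncurryFin (koszulTerm μ p)) ∘ₗ
      (ExtPower.equiv k V (p + 1)).toLinearMap)

/-- The formula for the Koszul differential on decomposable elements. -/
theorem koszulDifferential_tmul (μ : V →ₗ[k] M →ₗ[k] N) (p : ℕ) (v : Fin (p + 1) → V) (g : M) :
    koszulDifferential μ p (ExtPower.wedge k V (p + 1) v ⊗ₜ[k] g) =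
      ∑ i : Fin (p + 1), (-1 : ℤ) ^ (i : ℕ) •
        (ExtPower.wedge k V p (i.removeNth v) ⊗ₜ[k] μ (v i) g) := by
  simp [koszulDifferential, koszulTerm, ExtPower.wedge,
    AlternatingMap.alternatizeUncurryFin_apply, LinearMap.sum_apply]

/-- The kernel of the Koszul differential out of `⋀^p V ⊗ M`; the differential out of `⋀^0 V ⊗ M`
is zero. -/
def koszulCycles (μ : V →ₗ[k] M →ₗ[k] N) : (p : ℕ) → Submodule k (ExtPower k V p ⊗[k] M)
  | 0 => ⊤
  | p + 1 => LinearMap.ker (koszulDifferential μ p)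

/-- The cohomology at the middle term of
`⋀^(p+1) V ⊗ L → ⋀^p V ⊗ M → ⋀^(p-1) V ⊗ N`, where `μ₀ : V × L → M` and `μ₁ : V × M → N` are two
consecutive multiplication maps of a graded module over the symmetric algebra of `V`. -/
abbrev KoszulCohomology {L : Type*} [AddCommGroup L] [Module k L]
    (μ₀ : V →ₗ[k] L →ₗ[k] M) (μ₁ : V →ₗ[k] M →ₗ[k] N) (p : ℕ) : Type _ :=
  koszulCycles μ₁ p ⧸
    (LinearMap.range (koszulDifferential μ₀ p)).submoduleOf (koszulCycles μ₁ p)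

end Koszul

/-- The degree `e` piece `S_e` of `S = k[x₀, …, x_n]`, for an integer `e`; it is zero for `e < 0`. -/
def polyPiece (k : Type*) [Field k] (n : ℕ) (e : ℤ) :
    Submodule k (MvPolynomial (Fin (n + 1)) k) :=
  if 0 ≤ e then MvPolynomial.homogeneousSubmodule (Fin (n + 1)) k e.toNat else ⊥

theorem mul_mem_polyPiece {k : Type*} [Field k] {n d : ℕ} {e e' : ℤ} (h : e + d = e')
    {v g : MvPolynomial (Fin (n + 1)) k} (hv : v ∈ polyPiece k n d) (hg : g ∈ polyPiece k n e) :
    v * g ∈ polyPiece k n e' := by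
  subst h
  unfold polyPiece at *
  by_cases he : 0 ≤ e
  · rw [if_pos he] at hg
    rw [if_pos (by omega)] at hv
    rw [if_pos (by omega), show (e + d).toNat = d + e.toNat by omega]
    exact MvPolynomial.IsHomogeneous.mul hv hg
  · rw [if_neg he, Submodule.mem_bot] at hg
    simp [hg]

/-- The multiplication `S_d × S_e → S_{e'}` of polynomials, where `e' = e + d`. -/
def polyMul (k : Type*) [Field k] (n d : ℕ) (e e' : ℤ) (h : e + d = e') :
    polyPiece k n d →ₗ[k] polyPiece k n e →ₗ[k] polyPiece k n e' :=
  LinearMap.mk₂ k (fun v g => ⟨v.1 * g.1, mul_mem_polyPiece h v.2 g.2⟩)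
    (fun _ _ _ => Subtype.ext (add_mul _ _ _))
    (fun _ _ _ => Subtype.ext (smul_mul_assoc _ _ _))
    (fun _ _ _ => Subtype.ext (mul_add _ _ _))
    (fun _ _ _ => Subtype.ext (mul_smul_comm _ _ _))

/-- The Veronese Koszul cohomology group `K_{p,q}(n,b;d)` over the field `k`: the cohomology at the
middle term of
`⋀^(p+1) S_d ⊗ S_{(q-1)d+b} → ⋀^p S_d ⊗ S_{qd+b} → ⋀^(p-1) S_d ⊗ S_{(q+1)d+b}`. -/
abbrev VeroneseK (k : Type*) [Field k] (p : ℕ) (q : ℤ) (n : ℕ) (b : ℤ) (d : ℕ) : Type _ :=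
  KoszulCohomology
    (polyMul k n d ((q - 1) * d + b) (q * d + b) (by ring))
    (polyMul k n d (q * d + b) ((q + 1) * d + b) (by ring)) p

end VeroneseKoszul

end

namespace VeroneseKoszul

/-! ### Koszul differentials, determinantal functionals and explicit cycles. -/

section Abstract

variable {k V L M N : Type*} [CommRing k] [AddCommGroup V] [Module k V]
  [AddCommGroup L] [Module k L] [AddCommGroup M] [Module k M] [AddCommGroup N] [Module k N]

/-! Take the monomial `f = x_0^(d-1) ⋯ x_{m-1}^(d-1) x_m^r` of degree `qd + b`, and `p` distinct
monomials `v_i` of degree `d`, none a power of a variable. If each `v_i f` is divisible by some `u_i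
= x_{j i}^d`, then `v_1 ∧ ⋯ ∧ v_p ⊗ f` is a cycle modulo the `d`-th powers of the variables. It
lifts to an honest cycle: with `t_i = v_i / u_i` in the fraction field, expand `(v_1 - t_1 u_1) ∧ ⋯
∧ (v_p - t_p u_p) ⊗ f`. A denominator can survive only where some `u` is repeated, and there the
wedge vanishes.

If the `v_i` include all degree `d` divisors of `f`, the class is nonzero. The functional
"coefficient of `v_1 ∧ ⋯ ∧ v_p`, times coefficient of `f`" is 1 on the cycle and kills boundaries,
because the coefficient of `f` in `v g` involves only the coefficients of `v` at the `v_i`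
(`nontrivial_koszulCohomology`, `nontrivial_veroneseK_of_monomials`).

So every `p` between the number of divisors and the number of admissible monomials works, and
counting these two sets gives the two bounds. -/

theorem ExtPower.tensor_hom_ext {p : ℕ} {φ ψ : ExtPower k V p ⊗[k] M →ₗ[k] N}
    (h : ∀ v g, φ (ExtPower.wedge k V p v ⊗ₜ[k] g) = ψ (ExtPower.wedge k V p v ⊗ₜ[k] g)) :
    φ = ψ := by
  apply TensorProduct.ext
  have key : ((TensorProduct.mk k (ExtPower k V p) M).compr₂ φ) ∘ₗ
      (ExtPower.equiv k V p).symm.toLinearMap =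
      ((TensorProduct.mk k (ExtPower k V p) M).compr₂ ψ) ∘ₗ
      (ExtPower.equiv k V p).symm.toLinearMap := by
    apply exteriorPower.linearMap_ext
    ext v g
    exact h v g
  ext x g
  exact congrArg (fun T => T (ExtPower.equiv k V p x) g) key

/-- The functional `(w₁ ∧ ⋯ ∧ w_p) ⊗ g ↦ det (c_j w_i) * ψ g` on `⋀^p V ⊗ M`. -/
noncomputable def detFunctional {p : ℕ} (c : Fin p → V →ₗ[k] k) (ψ : M →ₗ[k] k) :
    ExtPower k V p ⊗[k] M →ₗ[k] k :=
  LinearMap.mul' k k ∘ₗ TensorProduct.map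
    (exteriorPower.alternatingMapLinearEquiv
      (Matrix.detRowAlternating.compLinearMap (LinearMap.pi c)) ∘ₗ
      (ExtPower.equiv k V p).toLinearMap) ψ

theorem detFunctional_tmul {p : ℕ} (c : Fin p → V →ₗ[k] k) (ψ : M →ₗ[k] k)
    (w : Fin p → V) (g : M) :
    detFunctional c ψ (ExtPower.wedge k V p w ⊗ₜ[k] g) =
      (Matrix.of fun i j => c j (w i)).det * ψ g := by
  simp only [detFunctional, ExtPower.wedge, LinearMap.comp_apply, TensorProduct.map_tmul,
    LinearMap.mul'_apply]
  congr 1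
  simp
  rfl

/-- On a boundary the functional is the Laplace expansion, along the first column, of a determinant
of size `p + 1` with first column `ψ (v_i g)`. By `h` this column is a combination of the others. -/
theorem detFunctional_comp_koszulDifferential {p : ℕ} (μ : V →ₗ[k] L →ₗ[k] M)
    (c : Fin p → V →ₗ[k] k) (ψ : M →ₗ[k] k)
    (h : ∀ g, ∃ s : Fin p → k, ∀ v, ψ (μ v g) = ∑ a, s a * c a v) :
    detFunctional c ψ ∘ₗ koszulDifferential μ p = 0 := by
  apply ExtPower.tensor_hom_ext
  intro v g
  obtain ⟨s, hs⟩ := h g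
  rw [LinearMap.comp_apply, koszulDifferential_tmul, map_sum, LinearMap.zero_apply]
  let A : Matrix (Fin (p + 1)) (Fin (p + 1)) k :=
    Matrix.of fun i j => Fin.cases (ψ (μ (v i) g)) (fun a => c a (v i)) j
  have hA : A.det = 0 := by
    let B : Matrix (Fin (p + 1)) (Fin (p + 1)) k :=
      Matrix.of fun i j => Fin.cases 0 (fun a => c a (v i)) j
    have hAB : A = B.updateCol 0 fun i => ∑ j, (Fin.cons 0 s : Fin (p + 1) → k) j • B i j := by
      ext i j
      refine Fin.cases ?_ (fun a => ?_) j
      · simp [A, B, hs, Fin.sum_univ_succ]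
      · simp [A, B]
    rw [hAB, Matrix.det_updateCol_sum, Fin.cons_zero, zero_smul]
  rw [← hA, Matrix.det_succ_column_zero]
  refine Finset.sum_congr rfl fun i _ => ?_
  rw [map_zsmul, detFunctional_tmul, zsmul_eq_mul]
  have : A.submatrix i.succAbove Fin.succ = Matrix.of fun i' j => c j (i.removeNth v i') := rfl
  rw [this]
  simp [A]
  ring

/-- Lets the cycle condition be checked after passing to a larger ring, where the `t_i` exist. -/
theorem koszulDifferential_naturality {M' N' : Type*} [AddCommGroup M'] [Module k M']
    [AddCommGroup N'] [Module k N'] (μ : V →ₗ[k] M →ₗ[k] N) (μ' : V →ₗ[k] M' →ₗ[k] N')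
    (α : M →ₗ[k] M') (β : N →ₗ[k] N') (h : ∀ v g, β (μ v g) = μ' v (α g)) (p : ℕ) :
    β.lTensor (ExtPower k V p) ∘ₗ koszulDifferential μ p =
      koszulDifferential μ' p ∘ₗ α.lTensor (ExtPower k V (p + 1)) := by
  apply ExtPower.tensor_hom_ext
  intro v g
  simp [koszulDifferential_tmul, h]

/-- The expansion of `(v₁ - t₁ u₁) ∧ ⋯ ∧ (v_p - t_p u_p) ⊗ c` is a cycle when `v_i` and `t_i u_i`
act in the same way. -/
theorem koszulDifferential_sum_piecewise {K : Type*} [CommRing K] [Algebra k K] {p : ℕ}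
    (ι : V →ₗ[k] K) (v u : Fin (p + 1) → V) (t : Fin (p + 1) → K)
    (ht : ∀ i, ι (v i) = t i * ι (u i)) (c : K) :
    koszulDifferential (LinearMap.mul k K ∘ₗ ι) p
      (∑ I : Finset (Fin (p + 1)), (-1 : ℤ) ^ I.card •
        (ExtPower.wedge k V (p + 1) (I.piecewise u v) ⊗ₜ[k] (c * ∏ i ∈ I, t i))) = 0 := by
  simp only [map_sum, map_zsmul, koszulDifferential_tmul, Finset.smul_sum]
  -- For a fixed omitted slot `i`, the terms of `I` and `insert i I` cancel: they differ only in
  -- slot `i`, where `v_i` and `t_i u_i` act alike, and have opposite signs.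
  rw [Finset.sum_comm]
  refine Finset.sum_eq_zero fun i _ => ?_
  have hi : i ∉ Finset.univ.erase i := by simp
  have huniv : (Finset.univ : Finset (Finset (Fin (p + 1)))) =
      (insert i (Finset.univ.erase i)).powerset := by
    rw [Finset.insert_erase (Finset.mem_univ i), Finset.powerset_univ]
  rw [huniv, Finset.sum_powerset_insert hi, ← Finset.sum_add_distrib]
  refine Finset.sum_eq_zero fun I hI => ?_
  have hiI : i ∉ I := fun h => hi (Finset.mem_powerset.1 hI h)
  have hw : i.removeNth ((insert i I).piecewise u v) = i.removeNth (I.piecewise u v) := by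
    funext j
    simp [Fin.removeNth_apply, Finset.piecewise, Fin.succAbove_ne]
  have hg : (LinearMap.mul k K ∘ₗ ι) ((insert i I).piecewise u v i)
      (c * ∏ i ∈ insert i I, t i) =
      (LinearMap.mul k K ∘ₗ ι) (I.piecewise u v i) (c * ∏ i ∈ I, t i) := by
    rw [Finset.prod_insert hiI, Finset.piecewise_eq_of_mem _ _ _ (Finset.mem_insert_self i I),
      Finset.piecewise_eq_of_notMem _ _ _ hiI]
    simp only [LinearMap.comp_apply, LinearMap.mul_apply', ht]
    ring
  rw [hw, hg, Finset.card_insert_of_notMem hiI, pow_succ]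
  simp

end Abstract

/-! ### The abstract nonvanishing criterion. -/

section Nonvanishing

variable {k V L M N K : Type*} [Field k] [AddCommGroup V] [Module k V]
  [AddCommGroup L] [Module k L] [AddCommGroup M] [Module k M] [AddCommGroup N] [Module k N]
  [CommRing K] [Algebra k K]

/-- A nonvanishing criterion for Koszul cohomology. The multiplication maps are modelled inside a
ring `K`, where `v_i = t_i u_i`; the class is that of the expansion of
`(v₁ - t₁ u₁) ∧ ⋯ ∧ (v_p - t_p u_p) ⊗ f`, and `c`, `ψ` detect its term `v₁ ∧ ⋯ ∧ v_p ⊗ f`. -/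
theorem nontrivial_koszulCohomology (μ₀ : V →ₗ[k] L →ₗ[k] M) (μ₁ : V →ₗ[k] M →ₗ[k] N) {p : ℕ}
    (ι : V →ₗ[k] K) (α : M →ₗ[k] K) (β : N →ₗ[k] K) (hβ : Function.Injective β)
    (hμ : ∀ v g, β (μ₁ v g) = ι v * α g)
    (v u : Fin p → V) (t : Fin p → K) (ht : ∀ i, ι (v i) = t i * ι (u i))
    (z : Finset (Fin p) → M)
    (hz : ∀ I, α (z I) = α (z ∅) * ∏ i ∈ I, t i ∨ ∃ i ∈ I, ∃ j ∈ I, i ≠ j ∧ u i = u j)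
    (c : Fin p → V →ₗ[k] k) (ψ : M →ₗ[k] k)
    (hcv : ∀ i j, c j (v i) = if i = j then 1 else 0) (hcu : ∀ i j, c j (u i) = 0)
    (hψ : ψ (z ∅) = 1)
    (h : ∀ g, ∃ s : Fin p → k, ∀ v, ψ (μ₀ v g) = ∑ a, s a * c a v) :
    Nontrivial (KoszulCohomology μ₀ μ₁ p) := by
  let Z : ExtPower k V p ⊗[k] M := ∑ I : Finset (Fin p), (-1 : ℤ) ^ I.card •
    (ExtPower.wedge k V p (I.piecewise u v) ⊗ₜ[k] z I)
  have hZ : Z ∈ koszulCycles μ₁ p := by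
    cases p with
    | zero => exact Submodule.mem_top
    | succ p =>
      have hinj : Function.Injective (β.lTensor (ExtPower k V p)) :=
        Module.Flat.lTensor_preserves_injective_linearMap β hβ
      rw [koszulCycles, LinearMap.mem_ker]
      apply hinj
      have hnat := LinearMap.congr_fun (koszulDifferential_naturality μ₁
        (LinearMap.mul k K ∘ₗ ι) α β hμ p) Z
      rw [LinearMap.comp_apply, LinearMap.comp_apply] at hnat
      rw [hnat, map_zero, ← koszulDifferential_sum_piecewise ι v u t ht (α (z ∅))]
      congr 1
      simp only [Z, map_sum, map_zsmul, LinearMap.lTensor_tmul]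
      refine Finset.sum_congr rfl fun I _ => ?_
      rcases hz I with hI | ⟨i, hi, j, hj, hij, hu⟩
      · rw [hI]
      · have : ExtPower.wedge k V (p + 1) (I.piecewise u v) = 0 :=
          AlternatingMap.map_eq_zero_of_eq _ _ (by simp [hi, hj, hu]) hij
        rw [this, TensorProduct.zero_tmul, TensorProduct.zero_tmul]
  have hφ : detFunctional c ψ Z = 1 := by
    simp only [Z, map_sum, map_zsmul, detFunctional_tmul]
    -- Only `I = ∅` counts: otherwise some row comes from a `u i`, on which every `c j` vanishes.
    rw [Finset.sum_eq_single ∅]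
    · have : (Matrix.of fun i j => c j ((∅ : Finset (Fin p)).piecewise u v i)) = 1 := by
        ext i j
        simp [hcv, Matrix.one_apply]
      rw [this]
      simp [hψ]
    · intro I _ hI
      obtain ⟨i, hi⟩ := Finset.nonempty_iff_ne_empty.2 hI
      rw [Matrix.det_eq_zero_of_row_eq_zero i fun j => by simp [hi, hcu], zero_mul, smul_zero]
    · simp
  rw [Submodule.Quotient.nontrivial_iff, Ne, Submodule.eq_top_iff']
  intro hall
  obtain ⟨y, hy⟩ : Z ∈ LinearMap.range (koszulDifferential μ₀ p) := hall ⟨Z, hZ⟩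
  have hzero := LinearMap.congr_fun (detFunctional_comp_koszulDifferential μ₀ c ψ h) y
  rw [LinearMap.comp_apply, hy, hφ] at hzero
  exact one_ne_zero hzero

end Nonvanishing

/-! ### The criterion for monomials. -/

section Monomials

open MvPolynomial

variable {k : Type*} [Field k] {n : ℕ}

theorem monomial_mem_polyPiece {e : ℤ} (he : 0 ≤ e) {a : Fin (n + 1) →₀ ℕ}
    (ha : (a.degree : ℤ) = e) : monomial a (1 : k) ∈ polyPiece k n e := by
  rw [polyPiece, if_pos he, mem_homogeneousSubmodule]
  exact isHomogeneous_monomial _ (by omega)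

theorem degree_eq_of_coeff_ne_zero {d : ℕ} {v : MvPolynomial (Fin (n + 1)) k}
    (hv : v ∈ polyPiece k n d) {a : Fin (n + 1) →₀ ℕ} (ha : coeff a v ≠ 0) : a.degree = d := by
  rw [polyPiece, if_pos (by omega), mem_homogeneousSubmodule] at hv
  by_contra h
  exact ha (hv.coeff_eq_zero (by simpa using h))

/-- The coefficient of `x^f` in a product with a form `v` of degree `d` depends only on the
coefficients of `v` at monomials dividing `x^f`. -/
theorem exists_coeff_mul_eq_sum {d p : ℕ} (f : Fin (n + 1) →₀ ℕ) {a : Fin p → Fin (n + 1) →₀ ℕ}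
    (ha : Function.Injective a) (hdiv : ∀ e, e.degree = d → e ≤ f → ∃ i, a i = e)
    (g : MvPolynomial (Fin (n + 1)) k) :
    ∃ s : Fin p → k, ∀ v ∈ polyPiece k n d, coeff f (v * g) = ∑ i, s i * coeff (a i) v := by
  refine ⟨fun i => ∑ x ∈ Finset.HasAntidiagonal.antidiagonal f, if x.1 = a i then coeff x.2 g else 0,
    fun v hv => ?_⟩
  simp only [coeff_mul, Finset.sum_mul]
  rw [Finset.sum_comm]
  refine Finset.sum_congr rfl fun x hx => ?_
  by_cases hx0 : coeff x.1 v = 0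
  · rw [hx0, zero_mul]
    refine (Finset.sum_eq_zero fun i _ => ?_).symm
    split_ifs with hi
    · rw [← hi, hx0, mul_zero]
    · rw [zero_mul]
  · have hle : x.1 ≤ f := by
      rw [← Finset.HasAntidiagonal.mem_antidiagonal.1 hx]
      exact le_self_add
    obtain ⟨i, hi⟩ := hdiv x.1 (degree_eq_of_coeff_ne_zero hv hx0) hle
    rw [Finset.sum_eq_single i, if_pos hi.symm, hi, mul_comm]
    · intro j _ hj
      rw [if_neg fun h => hj (ha (h.symm.trans hi.symm)), zero_mul]
    · simp

/-- In `f + ∑ a_i`, the variables `x_{j i}`, all different, have exponent at least `d`. -/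
theorem sum_single_le {ι : Type*} {d : ℕ} (f : Fin (n + 1) →₀ ℕ) (a : ι → Fin (n + 1) →₀ ℕ)
    (j : ι → Fin (n + 1)) (hj : ∀ i, d ≤ a i (j i) + f (j i)) (I : Finset ι)
    (hI : Set.InjOn j I) :
    ∑ i ∈ I, Finsupp.single (j i) d ≤ f + ∑ i ∈ I, a i := by
  intro y
  rw [Finsupp.add_apply, Finsupp.finsetSum_apply, Finsupp.finsetSum_apply]
  by_cases hy : ∃ i ∈ I, j i = y
  · obtain ⟨i, hi, rfl⟩ := hy
    rw [Finset.sum_eq_single_of_mem i hi fun i' hi' hne =>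
      Finsupp.single_eq_of_ne fun h => hne (hI hi' hi h.symm), Finsupp.single_eq_same]
    have := Finset.single_le_sum (f := fun i' => a i' (j i)) (fun _ _ => Nat.zero_le _) hi
    have := hj i
    omega
  · push Not at hy
    rw [Finset.sum_eq_zero fun i hi => Finsupp.single_eq_of_ne (hy i hi).symm]
    exact Nat.zero_le _

/-- The monomial criterion for nonvanishing: if `T` is a set of `p` monomials of degree `d`, none a
power of a variable, which contains all monomials of degree `d` dividing `f` and consists of
monomials that multiply `f` into `(x₀^d, …, x_n^d)`, then `K_{p,q}(n,b;d) ≠ 0`. -/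
theorem nontrivial_veroneseK_of_monomials {d p : ℕ} {q b : ℤ} (f : Fin (n + 1) →₀ ℕ)
    (hf : (f.degree : ℤ) = q * d + b) (T : Finset (Fin (n + 1) →₀ ℕ))
    (hT : T.card = p) (hdeg : ∀ a ∈ T, a.degree = d)
    (hpow : ∀ a ∈ T, ∀ i, a ≠ Finsupp.single i d)
    (hann : ∀ a ∈ T, ∃ i, d ≤ a i + f i) (hdiv : ∀ a, a.degree = d → a ≤ f → a ∈ T) :
    Nontrivial (VeroneseK k p q n b d) := by
  classical
  let E := T.equivFinOfCardEq hT
  let a : Fin p → Fin (n + 1) →₀ ℕ := fun i => (E.symm i).1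
  have ha : Function.Injective a := Subtype.val_injective.comp E.symm.injective
  have haT : ∀ i, a i ∈ T := fun i => (E.symm i).2
  choose j hj using fun i => hann (a i) (haT i)
  have hdZ : (0 : ℤ) ≤ d := by omega
  have he : 0 ≤ q * d + b := by omega
  let K := FractionRing (MvPolynomial (Fin (n + 1)) k)
  let A : MvPolynomial (Fin (n + 1)) k →ₐ[k] K := IsScalarTower.toAlgHom k _ K
  have hA : Function.Injective A := IsFractionRing.injective _ K
  let v : Fin p → polyPiece k n d := fun i =>
    ⟨monomial (a i) 1, monomial_mem_polyPiece hdZ (by rw [hdeg _ (haT i)])⟩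
  let u : Fin p → polyPiece k n d := fun i =>
    ⟨monomial (Finsupp.single (j i) d) 1, monomial_mem_polyPiece hdZ (by simp)⟩
  have hu : ∀ i, A (u i).1 ≠ 0 := fun i => by
    rw [Ne, map_eq_zero_iff A hA]
    simp [u]
  let F : Finset (Fin p) → Fin (n + 1) →₀ ℕ := fun I =>
    f + ∑ i ∈ I, a i - ∑ i ∈ I, Finsupp.single (j i) d
  have hF : ∀ I : Finset (Fin p), Set.InjOn j I → F I + ∑ i ∈ I, Finsupp.single (j i) d =
      f + ∑ i ∈ I, a i := fun I hI => tsub_add_cancel_of_le (sum_single_le f a j hj I hI)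
  have hFdeg : ∀ I : Finset (Fin p), Set.InjOn j I → ((F I).degree : ℤ) = q * d + b := by
    intro I hI
    have h := congrArg Finsupp.degree (hF I hI)
    simp only [map_add, map_sum, Finsupp.degree_single, hdeg _ (haT _)] at h
    rw [← hf]
    omega
  -- When `j` is not injective on `I`, the quotient need not be a polynomial; the default 0 is
  -- harmless because the wedge then repeats a `u`.
  let z : Finset (Fin p) → polyPiece k n (q * d + b) := fun I =>
    if hI : Set.InjOn j I then ⟨monomial (F I) 1, monomial_mem_polyPiece he (hFdeg I hI)⟩ else 0
  have hz0 : (z ∅).1 = monomial f 1 := by simp [z, F]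
  let co : (Fin (n + 1) →₀ ℕ) → ∀ e : ℤ, polyPiece k n e →ₗ[k] k := fun m e =>
    (lcoeff k m) ∘ₗ (polyPiece k n e).subtype
  refine nontrivial_koszulCohomology _ _ (K := K) (A.toLinearMap ∘ₗ Submodule.subtype _)
    (A.toLinearMap ∘ₗ Submodule.subtype _) (A.toLinearMap ∘ₗ Submodule.subtype _)
    (hA.comp Subtype.val_injective) (fun v g => map_mul A _ _) v u
    (fun i => A (v i).1 / A (u i).1) (fun i => (div_mul_cancel₀ _ (hu i)).symm) z ?_
    (fun i => co (a i) d) (co f _) ?_ ?_ ?_ ?_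
  · intro I
    by_cases hI : Set.InjOn j I
    · left
      change A (z I).1 = A (z ∅).1 * _
      rw [Finset.prod_div_distrib, ← mul_div_assoc,
        eq_div_iff (Finset.prod_ne_zero_iff.2 fun i _ => hu i), ← map_prod, ← map_prod, ← map_mul,
        ← map_mul, hz0]
      congr 1
      have h1 : ∀ m : Fin p → Fin (n + 1) →₀ ℕ,
          ∏ i ∈ I, monomial (m i) (1 : k) = monomial (∑ i ∈ I, m i) 1 := fun m => by
        rw [monomial_sum_one]
      simp only [z, dif_pos hI, v, u, h1, monomial_mul, one_mul, hF I hI]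
    · right
      rw [Set.InjOn] at hI
      push Not at hI
      obtain ⟨i, hi, i', hi', h, hne⟩ := hI
      exact ⟨i, hi, i', hi', hne, by simp [u, h]⟩
  · intro i i'
    simp [co, v, coeff_monomial, ha.eq_iff]
  · intro i i'
    change coeff (a i') (monomial (Finsupp.single (j i) d) 1) = 0
    rw [coeff_monomial, if_neg (hpow _ (haT i') _).symm]
  · change coeff f (z ∅).1 = 1
    rw [hz0, coeff_monomial, if_pos rfl]
  · intro g
    obtain ⟨s, hs⟩ := exists_coeff_mul_eq_sum (d := d) f ha (fun e h1 h2 =>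
      ⟨E ⟨e, hdiv e h1 h2⟩, by simp [a]⟩) g.1
    exact ⟨s, fun v => hs v.1 v.2⟩

end Monomials

/-! ### Counting divisors and annihilators of the staircase monomial. -/

section Counting

open Finset

/-- The exponent vector of `x_0^(d-1) ⋯ x_{m-1}^(d-1) x_m^r`. -/
noncomputable def stairExponent (n d m r : ℕ) : Fin (n + 1) →₀ ℕ :=
  Finsupp.equivFunOnFinite.symm fun i => if i.1 < m then d - 1 else if i.1 = m then r else 0

theorem stairExponent_apply (n d m r : ℕ) (i : Fin (n + 1)) :
    stairExponent n d m r i = if i.1 < m then d - 1 else if i.1 = m then r else 0 := rfl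

theorem stairExponent_lt {n d m r : ℕ} (hr : r < d) (i : Fin (n + 1)) :
    stairExponent n d m r i < d := by
  rw [stairExponent_apply]
  split_ifs <;> omega

theorem degree_stairExponent {n m : ℕ} (hm : m ≤ n) (d r : ℕ) :
    (stairExponent n d m r).degree = m * (d - 1) + r := by
  rw [Finsupp.degree_eq_sum]
  simp only [stairExponent_apply]
  rw [Fin.sum_univ_eq_sum_range (fun i => if i < m then d - 1 else if i = m then r else 0),
    show n + 1 = m + 1 + (n - m) by omega, sum_range_add, sum_range_succ,
    sum_congr rfl (g := fun _ => d - 1) fun i hi => by rw [if_pos (mem_range.1 hi)],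
    sum_eq_zero (s := range (n - m)) fun i _ => by rw [if_neg (by omega), if_neg (by omega)]]
  simp

theorem finsuppAntidiag_map_add_single {ι : Type*} [DecidableEq ι] {s : Finset ι} {i : ι}
    (hi : i ∈ s) (e c : ℕ) {a : ι →₀ ℕ} (ha : a ∈ s.finsuppAntidiag e) :
    a + Finsupp.single i c ∈ s.finsuppAntidiag (e + c) := by
  rw [mem_finsuppAntidiag] at ha ⊢
  refine ⟨?_, ?_⟩
  · rw [Finsupp.coe_add, Pi.add_def, sum_add_distrib, ha.1]
    rw [sum_eq_single_of_mem i hi fun j _ hj => Finsupp.single_eq_of_ne hj,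
      Finsupp.single_eq_same]
  · exact Finsupp.support_add.trans (union_subset ha.2
      (Finsupp.support_single_subset.trans (singleton_subset_iff.2 hi)))

theorem card_finsuppAntidiag_eq_choose {ι : Type*} [DecidableEq ι] {s : Finset ι} {c : ℕ}
    (hs : s.card = c + 1) (e : ℕ) : (s.finsuppAntidiag e).card = (c + e).choose e := by
  rw [card_finsuppAntidiag_nat_eq_choose, hs]
  congr 1
  omega

theorem card_filter_val_lt {n m : ℕ} (hm : m ≤ n + 1) :
    (univ.filter fun i : Fin (n + 1) => i.1 < m).card = m := by
  rw [Fin.card_filter_val_lt]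
  omega

theorem card_filter_le_val {n m : ℕ} (hm : m ≤ n) :
    (univ.filter fun i : Fin (n + 1) => m ≤ i.1).card = n - m + 1 := by
  have h := card_filter_add_card_filter_not (s := (univ : Finset (Fin (n + 1))))
    (fun i : Fin (n + 1) => i.1 < m)
  rw [card_filter_val_lt (by omega), card_univ, Fintype.card_fin] at h
  simp only [not_lt] at h
  omega

theorem single_injective {ι : Type*} {d : ℕ} (hd : d ≠ 0) :
    Function.Injective fun i : ι => Finsupp.single i d :=
  Finsupp.single_left_injective hd

/-- The monomials of degree `d` dividing `x^f`. -/
noncomputable def divisors {n : ℕ} (f : Fin (n + 1) →₀ ℕ) (d : ℕ) :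
    Finset (Fin (n + 1) →₀ ℕ) :=
  (univ.finsuppAntidiag d).filter (· ≤ f)

/-- The monomials of degree `d`, other than powers of a variable, that multiply `x^f` into
`(x₀^d, …, x_n^d)`. -/
noncomputable def annihilators {n : ℕ} (f : Fin (n + 1) →₀ ℕ) (d : ℕ) :
    Finset (Fin (n + 1) →₀ ℕ) :=
  (univ.finsuppAntidiag d).filter fun a => (∀ i, a ≠ Finsupp.single i d) ∧ ∃ i, d ≤ a i + f i

theorem mem_finsuppAntidiag_univ {n d : ℕ} {a : Fin (n + 1) →₀ ℕ} :
    a ∈ (univ : Finset (Fin (n + 1))).finsuppAntidiag d ↔ a.degree = d := by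
  rw [mem_finsuppAntidiag, Finsupp.degree_eq_sum]
  simp

/-- If a divisor `a` had all `a i + f i < d`, the exponents `d - 1` before `m` and `0` after `m`
would leave only `x_m^d`, which does not divide `f` as `r < d`. -/
theorem divisors_subset_annihilators {n d m r : ℕ} (hm : m ≤ n) (hr : r < d) :
    divisors (stairExponent n d m r) d ⊆ annihilators (stairExponent n d m r) d := by
  intro a ha
  rw [divisors, mem_filter] at ha
  rw [annihilators, mem_filter]
  refine ⟨ha.1, ?_, ?_⟩
  · rintro i rfl
    have h := ha.2 i
    have := stairExponent_lt (m := m) hr i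
    rw [Finsupp.single_eq_same] at h
    omega
  · by_contra! hlt
    have hdeg := mem_finsuppAntidiag_univ.1 ha.1
    rw [Finsupp.degree_eq_sum, sum_eq_single_of_mem (⟨m, by omega⟩ : Fin (n + 1)) (mem_univ _)]
      at hdeg
    · have h := ha.2 ⟨m, by omega⟩
      rw [stairExponent_apply] at h
      simp only [lt_irrefl, if_false, if_true] at h
      omega
    · intro i _ hi
      have hi' : i.1 ≠ m := fun h => hi (Fin.ext h)
      have h1 := hlt i
      have h2 := ha.2 i
      rw [stairExponent_apply] at h1 h2
      split_ifs at h1 h2 <;> omega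

/-- Among the degree `d` monomials in `x_0, …, x_m`, non-divisors include the `m` powers `x_i^d`
with `i < m` (the set `P`) and the multiples of `x_m^(r+1)` (the set `S`). -/
theorem card_divisors_stairExponent {n d m r : ℕ} (hm : m ≤ n) (hr : r < d) :
    (divisors (stairExponent n d m r) d).card + m + (m + d - r - 1).choose m ≤
      (m + d).choose m := by
  classical
  set f := stairExponent n d m r with hf
  let x : Fin (n + 1) := ⟨m, by omega⟩
  have hfx : f x = r := by simp [hf, stairExponent_apply, x]
  let U : Finset (Fin (n + 1)) := univ.filter fun i => i.1 < m + 1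
  have hU : U.card = m + 1 := card_filter_val_lt (by omega)
  have hxU : x ∈ U := by simp [U, x]
  let P : Finset (Fin (n + 1) →₀ ℕ) :=
    (univ.filter fun i : Fin (n + 1) => i.1 < m).image fun i => Finsupp.single i d
  have hP : P.card = m := by
    rw [card_image_of_injective _ (single_injective (by omega)), card_filter_val_lt (by omega)]
  let S := (U.finsuppAntidiag (d - r - 1)).image (· + Finsupp.single x (r + 1))
  have hS : S.card = (m + d - r - 1).choose m := by
    rw [card_image_of_injective _ (add_left_injective _), card_finsuppAntidiag_eq_choose hU,
      ← Nat.choose_symm_add, show m + (d - r - 1) = m + d - r - 1 by omega]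
  have hDP : Disjoint (divisors f d) P := by
    rw [disjoint_right]
    intro a ha ha'
    obtain ⟨i, -, rfl⟩ := mem_image.1 ha
    have h := (mem_filter.1 ha').2 i
    have : f i < d := stairExponent_lt hr i
    rw [Finsupp.single_eq_same] at h
    omega
  have hDS : Disjoint (divisors f d ∪ P) S := by
    rw [disjoint_right]
    intro a ha ha'
    obtain ⟨e, -, rfl⟩ := mem_image.1 ha
    rcases mem_union.1 ha' with h | h
    · have h := (mem_filter.1 h).2 x
      rw [hfx, Finsupp.add_apply, Finsupp.single_eq_same] at h
      omega
    · obtain ⟨i, hi, h⟩ := mem_image.1 h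
      have h := DFunLike.congr_fun h x
      rw [mem_filter] at hi
      rw [Finsupp.add_apply, Finsupp.single_eq_same,
        Finsupp.single_eq_of_ne fun h => by simp [← h, x] at hi] at h
      omega
  have hsub : divisors f d ∪ P ∪ S ⊆ U.finsuppAntidiag d := by
    refine union_subset (union_subset ?_ ?_) ?_
    · intro a ha
      rw [divisors, mem_filter, mem_finsuppAntidiag'] at ha
      refine mem_finsuppAntidiag'.2 ⟨ha.1.1, fun i hi => ?_⟩
      have h := ha.2 i
      rw [Finsupp.mem_support_iff] at hi
      rw [hf, stairExponent_apply] at h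
      refine mem_filter.2 ⟨mem_univ _, ?_⟩
      split_ifs at h <;> omega
    · intro a ha
      obtain ⟨i, hi, rfl⟩ := mem_image.1 ha
      have hiU : i ∈ U := by
        rw [mem_filter] at hi ⊢
        exact ⟨mem_univ _, by omega⟩
      simpa using finsuppAntidiag_map_add_single hiU 0 d (a := 0) (by simp)
    · intro a ha
      obtain ⟨e, he, rfl⟩ := mem_image.1 ha
      have := finsuppAntidiag_map_add_single hxU _ (r + 1) he
      rwa [show d - r - 1 + (r + 1) = d by omega] at this
  have h := card_le_card hsub
  rw [card_union_of_disjoint hDS, card_union_of_disjoint hDP, hP, hS,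
    card_finsuppAntidiag_eq_choose hU, ← Nat.choose_symm_add] at h
  exact h

/-- A monomial outside the set is either `x_i^d` with `i ≤ m` (the set `P`), or involves only `x_m,
…, x_n` with `x_m`-exponent below `d - r` (the set `B`). The complement of `B` there contains the
multiples `S` of `x_m^(d-r)`. -/
theorem card_annihilators_stairExponent {n d m r : ℕ} (hm : m ≤ n) (hr : r < d) :
    (n + d).choose n + (n - m + r).choose r ≤
      (annihilators (stairExponent n d m r) d).card + (m + 1) + (n - m + d).choose d := by
  classical
  set f := stairExponent n d m r with hf
  let x : Fin (n + 1) := ⟨m, by omega⟩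
  have hfx : f x = r := by simp [hf, stairExponent_apply, x]
  let U : Finset (Fin (n + 1)) := univ.filter fun i => m ≤ i.1
  have hU : U.card = n - m + 1 := card_filter_le_val hm
  have hxU : x ∈ U := by simp [U, x]
  let P : Finset (Fin (n + 1) →₀ ℕ) :=
    (univ.filter fun i : Fin (n + 1) => i.1 < m + 1).image fun i => Finsupp.single i d
  have hP : P.card = m + 1 := by
    rw [card_image_of_injective _ (single_injective (by omega)), card_filter_val_lt (by omega)]
  let S := (U.finsuppAntidiag r).image (· + Finsupp.single x (d - r))
  have hS : S.card = (n - m + r).choose r := by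
    rw [card_image_of_injective _ (add_left_injective _), card_finsuppAntidiag_eq_choose hU]
  let B := (U.finsuppAntidiag d).filter fun a => a x + r < d
  have hBS : Disjoint B S := by
    rw [disjoint_right]
    intro a ha ha'
    obtain ⟨e, -, rfl⟩ := mem_image.1 ha
    have h := (mem_filter.1 ha').2
    rw [Finsupp.add_apply, Finsupp.single_eq_same] at h
    omega
  have hsub : B ∪ S ⊆ U.finsuppAntidiag d := by
    refine union_subset (filter_subset _ _) ?_
    intro a ha
    obtain ⟨e, he, rfl⟩ := mem_image.1 ha
    have := finsuppAntidiag_map_add_single hxU _ (d - r) he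
    rwa [show r + (d - r) = d by omega] at this
  have hcover : (univ : Finset (Fin (n + 1))).finsuppAntidiag d ⊆ annihilators f d ∪ P ∪ B := by
    intro a ha
    by_cases haZ : a ∈ annihilators f d
    · exact mem_union_left _ (mem_union_left _ haZ)
    by_cases haP : a ∈ P
    · exact mem_union_left _ (mem_union_right _ haP)
    refine mem_union_right _ (mem_filter.2 ?_)
    by_cases hpow : ∃ i, a = Finsupp.single i d
    · obtain ⟨i, rfl⟩ := hpow
      have hi : m < i.1 := by
        by_contra h
        exact haP (mem_image_of_mem _ (mem_filter.2 ⟨mem_univ _, by omega⟩))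
      refine ⟨?_, ?_⟩
      · simpa using finsuppAntidiag_map_add_single (mem_filter.2 ⟨mem_univ i, hi.le⟩ : i ∈ U) 0 d
          (a := 0) (by simp)
      · rw [Finsupp.single_eq_of_ne fun h => by simp [← h, x] at hi]
        omega
    · have hlt : ∀ i, a i + f i < d := by
        by_contra! hex
        exact haZ (mem_filter.2 ⟨ha, fun i hi => hpow ⟨i, hi⟩, hex⟩)
      refine ⟨mem_finsuppAntidiag'.2 ⟨(mem_finsuppAntidiag'.1 ha).1, fun i hi => ?_⟩, ?_⟩
      · have h := hlt i
        rw [Finsupp.mem_support_iff] at hi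
        rw [hf, stairExponent_apply] at h
        refine mem_filter.2 ⟨mem_univ _, ?_⟩
        split_ifs at h <;> omega
      · have h := hlt x
        rwa [hfx] at h
  have h1 := card_le_card hsub
  have h2 := card_le_card hcover
  have h3 := card_union_le (annihilators f d ∪ P) B
  have h4 := card_union_le (annihilators f d) P
  rw [card_union_of_disjoint hBS, hS, card_finsuppAntidiag_eq_choose hU] at h1
  rw [card_finsuppAntidiag_eq_choose (c := n) (by simp), ← Nat.choose_symm_add] at h2
  omega

end Counting

/-- Allowing `r = d - 1`, which is not a remainder modulo `d - 1`, serves the boundary case `m = n +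
1` and the extreme cases of the two corollaries. -/
theorem nontrivial_veroneseK_of_le {k : Type*} [Field k] {n d m r p : ℕ} {q b : ℤ} (hm : m ≤ n)
    (hr : r < d) (he : q * d + b = (m * (d - 1) + r : ℕ))
    (hlow : (m + d).choose m ≤ p + m + (m + d - r - 1).choose m)
    (hupp : p + (n - m + d).choose d + m + 1 ≤ (n + d).choose n + (n - m + r).choose r) :
    Nontrivial (VeroneseK k p q n b d) := by
  have h1 := card_divisors_stairExponent hm hr
  have h2 := card_annihilators_stairExponent hm hr
  obtain ⟨T, hDT, hTZ, hT⟩ := Finset.exists_subsuperset_card_eq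
    (divisors_subset_annihilators hm hr) (n := p) (by omega) (by omega)
  have hmem := fun a (ha : a ∈ T) => Finset.mem_filter.1 (hTZ ha)
  refine nontrivial_veroneseK_of_monomials (stairExponent n d m r) ?_ T hT
    (fun a ha => mem_finsuppAntidiag_univ.1 (hmem a ha).1) (fun a ha => (hmem a ha).2.1)
    (fun a ha => (hmem a ha).2.2)
    (fun a hd hf => hDT (Finset.mem_filter.2 ⟨mem_finsuppAntidiag_univ.2 hd, hf⟩))
  rw [degree_stairExponent hm, he]

end VeroneseKoszul

/-! ### The theorem and its numerical boundary cases. -/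

theorem theorem1p1 (k : Type*) [Field k] :
    (∀ n d b q m r p : ℕ, 2 ≤ d → b ≤ d - 1 →
      (q : ℚ) ≤ (n : ℚ) + 1 - ((n : ℚ) + b) / d →
      m = (q * d + b) / (d - 1) → r = (q * d + b) % (d - 1) →
      ((m + d).choose m : ℤ) - ((m + d - r - 1).choose m : ℤ) - m ≤ p →
      (p : ℤ) ≤ ((n + d).choose n : ℤ) + Ring.choose ((n : ℤ) - m + r) r
        - Ring.choose ((n : ℤ) - m + d) d - m - 1 →
      Nontrivial (VeroneseKoszul.VeroneseK k p q n b d)) ∧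
    (∀ n d b q p : ℕ, 1 ≤ q → q ≤ n → q + b + 1 ≤ d →
      ((d + q).choose q : ℤ) - ((d - b - 1).choose q : ℤ) - q ≤ p →
      (p : ℤ) ≤ ((d + n).choose n : ℤ) - ((d + n - q).choose (n - q) : ℤ)
        + ((n + b).choose (n - q) : ℤ) - q - 1 →
      Nontrivial (VeroneseKoszul.VeroneseK k p q n b d)) ∧
    (∀ d p : ℕ, 3 ≤ d →
      3 * (d : ℤ) - 2 ≤ p → (p : ℤ) ≤ ((d + 2).choose 2 : ℤ) - 3 →
      Nontrivial (VeroneseKoszul.VeroneseK k p 2 2 0 d)) := by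
  refine ⟨?_, ?_, ?_⟩
  · intro n d b q m r p hd _ hq hm hr hlow hupp
    have hqN : q * d + b + n ≤ (n + 1) * d := by
      have hd0 : (0 : ℚ) < d := by exact_mod_cast (by omega : 0 < d)
      have h : (q : ℚ) * d ≤ ((n : ℚ) + 1 - ((n : ℚ) + b) / d) * d :=
        mul_le_mul_of_nonneg_right hq hd0.le
      rw [sub_mul, div_mul_cancel₀ _ hd0.ne'] at h
      have h' : (q : ℚ) * d + b + n ≤ (n + 1) * d := by linarith
      exact_mod_cast h'
    have hdiv : q * d + b = m * (d - 1) + r := by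
      rw [hm, hr]
      exact (Nat.div_add_mod' _ _).symm
    have hr' : r < d - 1 := hr ▸ Nat.mod_lt _ (by omega)
    clear hm hr hq
    rcases Nat.lt_or_ge n m with hnm | hnm
    · obtain ⟨c, rfl⟩ : ∃ c, d = c + 2 := ⟨d - 2, by omega⟩
      simp only [show c + 2 - 1 = c + 1 by omega] at hdiv hr'
      -- The bound on `q` says `m (d - 1) + r ≤ (n + 1) (d - 1) + 1`.
      have hm2 : m = n + 1 ∧ r ≤ 1 ∨ m = n + 2 ∧ r = 0 ∧ c = 0 := by
        rcases Nat.lt_or_ge m (n + 2) with h | h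
        · obtain rfl : m = n + 1 := by omega
          left
          refine ⟨rfl, ?_⟩
          nlinarith
        · right
          have h1 := Nat.mul_le_mul_right (c + 1) h
          have hc : c = 0 := by nlinarith
          subst hc
          omega
      rcases hm2 with ⟨rfl, hr1⟩ | ⟨rfl, rfl, rfl⟩
      · have hch : Ring.choose ((n : ℤ) - (n + 1 : ℕ) + (c + 2 : ℕ)) (c + 2) = 0 := by
          rw [show (n : ℤ) - (n + 1 : ℕ) + (c + 2 : ℕ) = ((c + 1 : ℕ) : ℤ) by push_cast; ring,
            Ring.choose_natCast, Nat.choose_succ_self, Nat.cast_zero]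
        rw [hch] at hupp
        have hpas : (n + 1 + (c + 2)).choose (n + 1) =
            (n + (c + 2)).choose n + (n + (c + 2)).choose (n + 1) := by
          rw [show n + 1 + (c + 2) = n + (c + 2) + 1 by omega, Nat.choose_succ_succ]
        interval_cases r
        -- Here `(n + 1) (d - 1) = n (d - 1) + (d - 1)`, so `f` is the staircase with `m = n` and `r
        -- = d - 1`; both bounds equal `(n + d).choose n - n - 1`.
        · rw [Ring.choose_zero_right] at hupp
          simp only [show n + 1 + (c + 2) - 0 - 1 = n + (c + 2) by omega] at hlow
          refine VeroneseKoszul.nontrivial_veroneseK_of_le (m := n) (r := c + 1) le_rfl (by omega)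
            ?_ ?_ ?_
          · rw [show c + 2 - 1 = c + 1 by omega,
              show n * (c + 1) + (c + 1) = (n + 1) * (c + 1) + 0 by ring, ← hdiv]
            push_cast
            ring
          · rw [show n + (c + 2) - (c + 1) - 1 = n by omega, Nat.choose_self]
            omega
          · simp only [Nat.sub_self, zero_add, Nat.choose_self]
            omega
        -- For `r = 1` the range of `p` is empty, by Pascal's rule and monotonicity.
        · exfalso
          have hz : Ring.choose ((n : ℤ) - (n + 1 : ℕ) + (1 : ℕ)) 1 = 0 := by
            rw [Ring.choose_one_right]
            push_cast
            ring
          rw [hz] at hupp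
          have hmono : (n + 1 + (c + 2) - 1 - 1).choose (n + 1) ≤
              (n + (c + 2)).choose (n + 1) := Nat.choose_le_choose _ (by omega)
          omega
      -- Here `d = 2`, and the lower bound exceeds the upper one by `(n + 2).choose (n + 1)`.
      · exfalso
        have hz : Ring.choose ((n : ℤ) - (n + 2 : ℕ) + (0 + 2 : ℕ)) (0 + 2) = 0 := by
          rw [show (n : ℤ) - (n + 2 : ℕ) + (0 + 2 : ℕ) = 0 by push_cast; ring]
          exact Ring.choose_zero_pos ℤ (by omega)
        rw [hz, Ring.choose_zero_right] at hupp
        have h1 : (n + 2 + (0 + 2)).choose (n + 2) =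
            (n + 3).choose (n + 1) + (n + 3).choose (n + 2) := Nat.choose_succ_succ (n + 3) (n + 1)
        have h2 : (n + 3).choose (n + 1) = (n + 2).choose n + (n + 2).choose (n + 1) :=
          Nat.choose_succ_succ (n + 2) n
        have h3 : 0 < (n + 2).choose (n + 1) := Nat.choose_pos (by omega)
        simp only [show n + 2 + (0 + 2) - 0 - 1 = n + 3 by omega] at hlow
        simp only [Nat.zero_add] at *
        omega
    · have h1 : Ring.choose ((n : ℤ) - m + r) r = ((n - m + r).choose r : ℕ) := by
        rw [← Ring.choose_natCast]
        congr 1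
        omega
      have h2 : Ring.choose ((n : ℤ) - m + d) d = ((n - m + d).choose d : ℕ) := by
        rw [← Ring.choose_natCast]
        congr 1
        omega
      rw [h1, h2] at hupp
      refine VeroneseKoszul.nontrivial_veroneseK_of_le hnm (by omega : r < d) ?_ (by omega)
        (by omega)
      exact_mod_cast hdiv
  · intro n d b q p _ hqn hd hlow hupp
    have h1 : (d + n - q).choose (n - q) = (n - q + d).choose d := by
      rw [← Nat.choose_symm_add, show d + n - q = n - q + d by omega]
    have h2 : (n + b).choose (n - q) = (n - q + (q + b)).choose (q + b) := by
      rw [← Nat.choose_symm_add, show n + b = n - q + (q + b) by omega]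
    rw [h1, h2, add_comm d n] at hupp
    rw [add_comm d q] at hlow
    -- `qd + b = q (d - 1) + (q + b)`, so `m = q` and `r = q + b`.
    refine VeroneseKoszul.nontrivial_veroneseK_of_le hqn (by omega : q + b < d) ?_ ?_ (by omega)
    · obtain ⟨c, rfl⟩ : ∃ c, d = c + 1 := ⟨d - 1, by omega⟩
      rw [Nat.add_sub_cancel]
      push_cast
      ring
    · rw [show q + d - (q + b) - 1 = d - b - 1 by omega]
      omega
  · intro d p hd hlow hupp
    obtain ⟨c, rfl⟩ : ∃ c, d = c + 1 := ⟨d - 1, by omega⟩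
    have hch : (c + 3).choose 2 = c.choose 2 + 3 * c + 3 := by
      simp only [Nat.choose_succ_succ', Nat.choose_zero_right]
      rw [Nat.choose_one_right]
      ring
    -- `2d = 2 (d - 1) + 2`; for `d = 3` this again has `r = d - 1`.
    refine VeroneseKoszul.nontrivial_veroneseK_of_le (m := 2) (r := 2) le_rfl (by omega) ?_ ?_ ?_
    · push_cast
      ring
    · rw [show 2 + (c + 1) - 2 - 1 = c by omega, show 2 + (c + 1) = c + 3 by omega]
      omega
    · simp only [Nat.sub_self, zero_add, Nat.choose_self, add_comm 2 (c + 1)]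
      omega
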